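/- Let $l\ge 1$, let $x=(x_1,\dots,x_l)$ be indeterminates over a field $K$ of characteristic $0$, and define formal power series $f_n(x)\in K[[x_1,\dots,x_l]]$ ($n\in\mathbb Z$) by $$\prod_{i=1}^{l}\frac{1}{(1-x_iz)(1-x_iz^{-1})}=\sum_{n\in\mathbb Z}f_n(x)z^n ,$$ where the left-hand side is expanded in nonnegative powers of the $x_i$, i.e. in $K[z,z^{-1}][[x_1,\dots,x_l]]$. Let $\lambda=(\lambda_1\ge\dots\ge\lambda_l\ge 0)$ be a sequence of integers, and let $$s_\lambda(x)=\frac{\det\bigl(x_i^{\lambda_j+l-j}\bigr)_{1\le i,j\le l}}{\det\bigl(x_i^{l-j}\bigr)_{1\le i,j\le l}}$$ be the Schur polynomial. Then, in $K[[x_1,\dots,x_l]]$, $$\det\bigl(f_{\lambda_i-i+j}(x)-f_{\lambda_i-i-j+2l+2}(x)\bigr)_{1\le i,j\le l}=\frac{s_\lambda(x)}{\prod_{1\le i<j\le l}(1-x_ix_j)},$$ $$\det\bigl(f_{\lambda_i-i+j}(x)-f_{\lambda_i-i-j+2l+1}(x)\bigr)_{1\le i,j\le l}=\frac{s_\lambda(x)}{\prod_{1\le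 j\le l}(1+x_j)\prod_{1\le i<j\le l}(1-x_ix_j)},$$ $$\frac12\det\bigl(f_{\lambda_i-i+j}(x)+f_{\lambda_i-i-j+2l}(x)\bigr)_{1\le i,j\le l}=\frac{s_\lambda(x)}{\prod_{1\le i\le j\le l}(1-x_ix_j)}.$$ -/

import Mathlib

open scoped LaurentPolynomial

noncomputable section

/-- The series `∏ᵢ 1 / ((1 - xᵢ z) (1 - xᵢ z⁻¹))`, as a formal power series in the variables
`x₀, …, x_{l-1}` whose coefficients are Laurent polynomials in `z`. -/
def genSeries (R : Type*) [CommRing R] (l : ℕ) : MvPowerSeries (Fin l) R[T;T⁻¹] :=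
  ∏ i : Fin l,
    (MvPowerSeries.invOfUnit
        (1 - MvPowerSeries.X i * MvPowerSeries.C (LaurentPolynomial.T 1)) 1 *
      MvPowerSeries.invOfUnit
        (1 - MvPowerSeries.X i * MvPowerSeries.C (LaurentPolynomial.T (-1))) 1)

/-- The inverses in `genSeries` are genuine. -/
theorem genSeries_spec (R : Type*) [CommRing R] (l : ℕ) :
    genSeries R l * ∏ i : Fin l,
      ((1 - MvPowerSeries.X i * MvPowerSeries.C (LaurentPolynomial.T 1)) *
        (1 - MvPowerSeries.X i * MvPowerSeries.C (LaurentPolynomial.T (-1)))) = 1 := by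
  unfold genSeries
  rw [← Finset.prod_mul_distrib]
  refine Finset.prod_eq_one fun i _ => ?_
  rw [mul_mul_mul_comm, MvPowerSeries.invOfUnit_mul _ _ (by simp),
    MvPowerSeries.invOfUnit_mul _ _ (by simp), one_mul]

/-- `fCoeff R l n` is the coefficient `f_n(x)` of `zⁿ` in `genSeries`, a formal power series in
`x₀, …, x_{l-1}`. -/
def fCoeff (R : Type*) [CommRing R] (l : ℕ) (n : ℤ) : MvPowerSeries (Fin l) R :=
  fun d => (MvPowerSeries.coeff d (genSeries R l)).coeff n

/-- The alternant `a_α = det (xᵢ ^ αⱼ)`. -/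
def alternant (R : Type*) [CommRing R] {l : ℕ} (α : Fin l → ℕ) : MvPolynomial (Fin l) R :=
  (Matrix.of fun i j : Fin l => (MvPolynomial.X i : MvPolynomial (Fin l) R) ^ α j).det

theorem prod_sub_dvd_det_eval {R : Type*} [CommRing R] (n : ℕ) (v : Fin n → R)
    (p : Fin n → Polynomial R) :
    (∏ i : Fin n, ∏ j ∈ Finset.Ioi i, (v j - v i)) ∣
      (Matrix.of fun i j : Fin n => (p j).eval (v i)).det := by
  induction n with
  | zero => simp
  | succ n ih =>
    have key : ∀ j, ∃ q : Polynomial R, p j - Polynomial.C ((p j).eval (v 0)) =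
        (Polynomial.X - Polynomial.C (v 0)) * q := fun j =>
      Polynomial.X_sub_C_dvd_sub_C_eval
    choose q hq using key
    have hdet : (Matrix.of fun i j : Fin (n + 1) => (p j).eval (v i)).det =
        (Matrix.of fun i j : Fin (n + 1) =>
          Fin.cases ((p j).eval (v 0)) (fun k : Fin n => (v k.succ - v 0) * (q j).eval (v k.succ))
            i).det := by
      refine Matrix.det_eq_of_forall_row_eq_smul_add_const
        (fun i : Fin (n + 1) => if i = 0 then 0 else 1) 0 (by simp) ?_
      intro i j
      refine Fin.cases ?_ (fun k => ?_) i
      · simp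
      · have h := congrArg (Polynomial.eval (v k.succ)) (hq j)
        simp at h
        simp [← h]
    rw [hdet, Matrix.det_succ_row_zero, Fin.prod_univ_succ]
    refine Finset.dvd_sum fun j _ => Dvd.dvd.mul_left ?_ _
    have hsub : (Matrix.submatrix (Matrix.of fun i j : Fin (n + 1) =>
          (Fin.cases ((p j).eval (v 0))
            (fun k : Fin n => (v k.succ - v 0) * (q j).eval (v k.succ)) i : R))
          Fin.succ j.succAbove).det =
        (∏ k : Fin n, (v k.succ - v 0)) *
          (Matrix.of fun i k : Fin n => (q (j.succAbove k)).eval (v i.succ)).det := by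
      rw [← Matrix.det_mul_column]
      rfl
    rw [hsub, Fin.Ioi_zero_eq_map, Finset.prod_map]
    refine mul_dvd_mul (dvd_of_eq rfl) ?_
    have := ih (fun i => v i.succ) (fun k => q (j.succAbove k))
    simpa only [Fin.prod_Ioi_succ] using this

theorem alternant_delta (R : Type*) [CommRing R] (l : ℕ) :
    alternant R (fun j : Fin l => l - 1 - (j : ℕ)) ∣
      ∏ i : Fin l, ∏ j ∈ Finset.Ioi i,
        ((MvPolynomial.X j : MvPolynomial (Fin l) R) - MvPolynomial.X i) := by
  have h : alternant R (fun j : Fin l => l - 1 - (j : ℕ)) =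
      ((Matrix.vandermonde fun i : Fin l =>
        (MvPolynomial.X i : MvPolynomial (Fin l) R)).submatrix id Fin.revPerm).det := by
    unfold alternant
    congr 1
    ext1 i j
    simp only [Matrix.of_apply, Matrix.submatrix_apply, Matrix.vandermonde_apply, id,
      Fin.revPerm_apply, Fin.val_rev]
    congr 1
    omega
  rw [h, Matrix.det_permute', Matrix.det_vandermonde]
  rcases Int.units_eq_one_or (Equiv.Perm.sign (Fin.revPerm : Equiv.Perm (Fin l))) with h | h <;>
    simp [h]

/-- Every alternant is divisible by the Vandermonde alternant `a_δ`, `δ = (l-1, l-2, …, 0)`. -/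
theorem alternant_delta_dvd (R : Type*) [CommRing R] {l : ℕ} (α : Fin l → ℕ) :
    alternant R (fun j : Fin l => l - 1 - (j : ℕ)) ∣ alternant R α := by
  refine (alternant_delta R l).trans ?_
  simpa [alternant] using prod_sub_dvd_det_eval l
    (fun i => (MvPolynomial.X i : MvPolynomial (Fin l) R)) (fun j => Polynomial.X ^ α j)

/-- The Schur polynomial `s_λ(x₀, …, x_{l-1}) = a_{λ+δ} / a_δ`. -/
def schurPoly (R : Type*) [CommRing R] {l : ℕ} (lam : Fin l → ℕ) : MvPolynomial (Fin l) R :=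
  (alternant_delta_dvd R (fun j : Fin l => lam j + (l - 1 - (j : ℕ)))).choose

theorem schurPoly_spec (R : Type*) [CommRing R] {l : ℕ} (lam : Fin l → ℕ) :
    alternant R (fun j : Fin l => lam j + (l - 1 - (j : ℕ))) =
      alternant R (fun j : Fin l => l - 1 - (j : ℕ)) * schurPoly R lam :=
  (alternant_delta_dvd R (fun j : Fin l => lam j + (l - 1 - (j : ℕ)))).choose_spec

end

noncomputable section

/-! The generating function has a partial fraction expansion in `z`: for `n ≥ -(l-1)`, `f_n = ∑ₖ rₖ
xₖ^(n+l-1)` with `rₖ⁻¹ = ∏ᵢ (1 - xᵢxₖ) ∏_{i≠k} (xₖ - xᵢ)` (`eq_sum_residue_mul_pow`). Every index in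
the three determinants lies in this range, so each matrix factors as the transposed alternant matrix
of `λ+δ`, times `diag(rₖ)`, times a matrix with entries `xₖ^j ∓ xₖ^(N-j)`, where `N` is `2l`, `2l-1`
or `2l-2` (`det_sum_mul_mul`). The last determinant is a Weyl denominator of type C, B or D. Up to
column factors it is a Vandermonde determinant in `xₖ + xₖ⁻¹` (`det_pow_mul_chebPoly_eval`). Its
product formula and `prod_residue` leave the stated denominators.

The expansion is obtained without residues. `sum_coprod_mul_fCoeff` shows over power series that a
combination of the `f_n` is geometric in `n`; the resulting linear system is then inverted in the
fraction field. -/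

/-- The coefficient of `zⁿ` in a power series whose coefficients are Laurent polynomials in `z`. -/
def zCoeff {R σ : Type*} [CommRing R] (n : ℤ) :
    MvPowerSeries σ R[T;T⁻¹] →+ MvPowerSeries σ R where
  toFun φ := fun d => (MvPowerSeries.coeff d φ).coeff n
  map_zero' := by ext d; rfl
  map_add' φ ψ := by ext d; rfl

/-! ### Extraction of coefficients in `z` -/

section zCoeff

variable {R σ : Type*} [CommRing R]

theorem coeff_zCoeff (n : ℤ) (φ : MvPowerSeries σ R[T;T⁻¹]) (d : σ →₀ ℕ) :
    MvPowerSeries.coeff d (zCoeff n φ) = (MvPowerSeries.coeff d φ).coeff n := rfl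

theorem fCoeff_eq_zCoeff (l : ℕ) (n : ℤ) : fCoeff R l n = zCoeff n (genSeries R l) := rfl

theorem zCoeff_one (n : ℤ) :
    zCoeff n (1 : MvPowerSeries σ R[T;T⁻¹]) = if n = 0 then 1 else 0 := by
  classical
  ext d
  rw [coeff_zCoeff, MvPowerSeries.coeff_one]
  by_cases hd : d = 0 <;> by_cases hn : n = 0 <;>
    simp [hd, hn, MvPowerSeries.coeff_one, ← LaurentPolynomial.T_zero, eq_comm]

theorem laurent_coeff_C_mul (r : R) (p : R[T;T⁻¹]) (n : ℤ) :
    (LaurentPolynomial.C r * p).coeff n = r * p.coeff n := by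
  simp [← LaurentPolynomial.smul_eq_C_mul]

theorem laurent_coeff_T_mul (m : ℤ) (p : R[T;T⁻¹]) (n : ℤ) :
    (LaurentPolynomial.T m * p).coeff n = p.coeff (n - m) := by
  have h := AddMonoidAlgebra.coeff_single_mul_eq_mul_coeff (r := (1 : R)) (m := m) (m₁ := n)
    (n - m) (x := p) (by intro a _; constructor <;> intro h <;> omega)
  rwa [one_mul] at h

theorem zCoeff_map_C_mul (a : MvPowerSeries σ R) (φ : MvPowerSeries σ R[T;T⁻¹]) (n : ℤ) :
    zCoeff n (MvPowerSeries.map LaurentPolynomial.C a * φ) = a * zCoeff n φ := by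
  classical
  ext d
  rw [coeff_zCoeff, MvPowerSeries.coeff_mul, MvPowerSeries.coeff_mul]
  simp [laurent_coeff_C_mul, coeff_zCoeff]

theorem zCoeff_X_mul (i : σ) (φ : MvPowerSeries σ R[T;T⁻¹]) (n : ℤ) :
    zCoeff n (MvPowerSeries.X i * φ) = MvPowerSeries.X i * zCoeff n φ := by
  rw [← zCoeff_map_C_mul, MvPowerSeries.map_X]

theorem zCoeff_T_mul (m : ℤ) (φ : MvPowerSeries σ R[T;T⁻¹]) (n : ℤ) :
    zCoeff n (MvPowerSeries.C (LaurentPolynomial.T m) * φ) = zCoeff (n - m) φ := by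
  ext d
  rw [coeff_zCoeff, MvPowerSeries.coeff_C_mul, laurent_coeff_T_mul, coeff_zCoeff]

theorem zCoeff_mul_one_sub (φ : MvPowerSeries σ R[T;T⁻¹]) (i : σ) (m n : ℤ) :
    zCoeff n (φ * (1 - MvPowerSeries.X i * MvPowerSeries.C (LaurentPolynomial.T m))) =
      zCoeff n φ - MvPowerSeries.X i * zCoeff (n - m) φ := by
  rw [show φ * (1 - MvPowerSeries.X i * MvPowerSeries.C (LaurentPolynomial.T m)) =
    φ - MvPowerSeries.X i * (MvPowerSeries.C (LaurentPolynomial.T m) * φ) by ring,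
    map_sub, zCoeff_X_mul, zCoeff_T_mul]

theorem toLaurent_coeff_of_neg (p : Polynomial R) {n : ℤ} (hn : n < 0) :
    (Polynomial.toLaurent p).coeff n = 0 := by
  rw [LaurentPolynomial.coeff_toLaurent, Finsupp.mapDomain_of_notMem_range]
  rintro ⟨m, hm⟩
  simp at hm
  omega

/-- Power series whose coefficients are polynomials in `z`. -/
def mapToLaurent : MvPowerSeries σ (Polynomial R) →+* MvPowerSeries σ R[T;T⁻¹] :=
  MvPowerSeries.map Polynomial.toLaurent

/-- Power series whose coefficients are polynomials in `z⁻¹`. -/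
def mapToLaurentInv : MvPowerSeries σ (Polynomial R) →+* MvPowerSeries σ R[T;T⁻¹] :=
  MvPowerSeries.map
    ((LaurentPolynomial.invert (R := R) : R[T;T⁻¹] →+* R[T;T⁻¹]).comp Polynomial.toLaurent)

theorem zCoeff_mapToLaurent (φ : MvPowerSeries σ (Polynomial R)) {n : ℤ} (hn : n < 0) :
    zCoeff n (mapToLaurent φ) = 0 := by
  ext d
  rw [coeff_zCoeff, mapToLaurent, MvPowerSeries.coeff_map, toLaurent_coeff_of_neg _ hn]
  simp

theorem zCoeff_mapToLaurentInv (φ : MvPowerSeries σ (Polynomial R)) {n : ℤ} (hn : 0 < n) :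
    zCoeff n (mapToLaurentInv φ) = 0 := by
  ext d
  rw [coeff_zCoeff, mapToLaurentInv, MvPowerSeries.coeff_map]
  simp only [RingHom.comp_apply, RingHom.coe_coe, LaurentPolynomial.invert_apply]
  rw [toLaurent_coeff_of_neg _ (by omega)]
  simp

/-- The geometric series `1 / (1 - xᵢ z)` with coefficients in `R[z]`. -/
def geomSeries (i : σ) : MvPowerSeries σ (Polynomial R) :=
  MvPowerSeries.invOfUnit (1 - MvPowerSeries.X i * MvPowerSeries.C Polynomial.X) 1

theorem geomSeries_mul (i : σ) :
    geomSeries (R := R) i * (1 - MvPowerSeries.X i * MvPowerSeries.C Polynomial.X) = 1 :=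
  MvPowerSeries.invOfUnit_mul _ _ (by simp)

theorem mapToLaurent_geomSeries_mul (i : σ) : mapToLaurent (geomSeries (R := R) i) *
    (1 - MvPowerSeries.X i * MvPowerSeries.C (LaurentPolynomial.T 1)) = 1 := by
  have := congrArg mapToLaurent (geomSeries_mul (R := R) i)
  simpa [mapToLaurent] using this

theorem mapToLaurentInv_geomSeries_mul (i : σ) : mapToLaurentInv (geomSeries (R := R) i) *
    (1 - MvPowerSeries.X i * MvPowerSeries.C (LaurentPolynomial.T (-1))) = 1 := by
  have := congrArg mapToLaurentInv (geomSeries_mul (R := R) i)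
  simpa [mapToLaurentInv] using this

theorem zCoeff_zero_mapToLaurent_geomSeries (i : σ) :
    zCoeff 0 (mapToLaurent (geomSeries (R := R) i)) = 1 := by
  have h := congrArg (zCoeff 0) (mapToLaurent_geomSeries_mul (R := R) i)
  rw [zCoeff_mul_one_sub, zCoeff_mapToLaurent (n := 0 - 1) _ (by norm_num), zCoeff_one] at h
  simpa using h

/-- Multiplication by `1 - xᵢ z⁻¹` turns coefficients `aₙ` into `aₙ - xᵢ aₙ₊₁`, hence rescales a
geometric sequence by `1 - xᵢ b`. The shift is upwards, so knowing `n ≥ 0` suffices. -/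
theorem zCoeff_mul_prod_one_sub (φ : MvPowerSeries σ R[T;T⁻¹]) (b c : MvPowerSeries σ R)
    (h : ∀ n : ℕ, zCoeff n φ = b ^ n * c) (s : Finset σ) (n : ℕ) :
    zCoeff n (φ * ∏ i ∈ s,
      (1 - MvPowerSeries.X i * MvPowerSeries.C (LaurentPolynomial.T (-1)))) =
      b ^ n * c * ∏ i ∈ s, (1 - MvPowerSeries.X i * b) := by
  classical
  induction s using Finset.induction_on generalizing n with
  | empty => simp [h]
  | insert i s hi ih =>
    rw [Finset.prod_insert hi, Finset.prod_insert hi, mul_left_comm, mul_comm,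
      zCoeff_mul_one_sub, ih, show (n : ℤ) - (-1) = ((n + 1 : ℕ) : ℤ) by push_cast; ring, ih]
    ring

end zCoeff

/-! ### Linear relations among the `f_n` -/

section genSeries

variable (R : Type*) [CommRing R] {l : ℕ}

theorem isUnit_of_mul_eq_one_left {M : Type*} [CommMonoid M] {a b : M} (h : a * b = 1) :
    IsUnit b := IsUnit.of_mul_eq_one a (by rwa [mul_comm])

theorem genSeries_mul_prod : genSeries R l * ∏ i : Fin l,
      (1 - MvPowerSeries.X i * MvPowerSeries.C (LaurentPolynomial.T 1)) =
    mapToLaurentInv (∏ i : Fin l, geomSeries i) := by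
  have hu : (∏ i : Fin l, mapToLaurentInv (geomSeries (R := R) i)) * ∏ i : Fin l,
      (1 - MvPowerSeries.X i * MvPowerSeries.C (LaurentPolynomial.T (-1))) = 1 := by
    rw [← Finset.prod_mul_distrib]
    exact Finset.prod_eq_one fun i _ => mapToLaurentInv_geomSeries_mul i
  apply (isUnit_of_mul_eq_one_left hu).mul_right_cancel
  rw [map_prod, hu, mul_assoc, ← Finset.prod_mul_distrib, genSeries_spec]

theorem genSeries_mul_prod_inv : genSeries R l * ∏ i : Fin l,
      (1 - MvPowerSeries.X i * MvPowerSeries.C (LaurentPolynomial.T (-1))) =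
    mapToLaurent (∏ i : Fin l, geomSeries i) := by
  have hu : (∏ i : Fin l, mapToLaurent (geomSeries (R := R) i)) * ∏ i : Fin l,
      (1 - MvPowerSeries.X i * MvPowerSeries.C (LaurentPolynomial.T 1)) = 1 := by
    rw [← Finset.prod_mul_distrib]
    exact Finset.prod_eq_one fun i _ => mapToLaurent_geomSeries_mul i
  apply (isUnit_of_mul_eq_one_left hu).mul_right_cancel
  rw [map_prod, hu, mul_right_comm, mul_assoc, ← Finset.prod_mul_distrib, genSeries_spec]

/-- Restoring the omitted factor `1 - xₖ z` leaves no positive powers of `z`, so the coefficients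
for `n ≥ 0` are geometric of ratio `xₖ`. Multiplying instead by all `1 - xᵢ z⁻¹` gives `1 / (1 - xₖ
z)`, whose constant term in `z` fixes the leading coefficient. -/
theorem zCoeff_genSeries_mul_prod_erase (k : Fin l) (n : ℕ) :
    zCoeff n (genSeries R l * ∏ i ∈ Finset.univ.erase k,
      (1 - MvPowerSeries.X i * MvPowerSeries.C (LaurentPolynomial.T 1))) *
      ∏ i : Fin l, (1 - MvPowerSeries.X i * MvPowerSeries.X k) = MvPowerSeries.X k ^ n := by
  set φ := genSeries R l * ∏ i ∈ Finset.univ.erase k,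
      (1 - MvPowerSeries.X i * MvPowerSeries.C (LaurentPolynomial.T 1)) with hφ
  have h1 : φ * (1 - MvPowerSeries.X k * MvPowerSeries.C (LaurentPolynomial.T 1)) =
      mapToLaurentInv (∏ i : Fin l, geomSeries i) := by
    rw [hφ, mul_assoc, Finset.prod_erase_mul _ _ (Finset.mem_univ k), genSeries_mul_prod]
  have h2 : ∀ n : ℕ, zCoeff n φ = MvPowerSeries.X k ^ n * zCoeff 0 φ := by
    intro n
    induction n with
    | zero => simp
    | succ n ih =>
      have h := congrArg (zCoeff ((n : ℤ) + 1)) h1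
      rw [zCoeff_mul_one_sub, zCoeff_mapToLaurentInv _ (by omega), add_sub_cancel_right, ih,
        sub_eq_zero] at h
      push_cast
      rw [h]
      ring
  have h3 : φ * ∏ i : Fin l,
      (1 - MvPowerSeries.X i * MvPowerSeries.C (LaurentPolynomial.T (-1))) =
      mapToLaurent (geomSeries k) := by
    apply (isUnit_of_mul_eq_one_left (mapToLaurent_geomSeries_mul (R := R) k)).mul_right_cancel
    rw [mapToLaurent_geomSeries_mul, mul_right_comm, h1, map_prod, ← Finset.prod_mul_distrib]
    exact Finset.prod_eq_one fun i _ => mapToLaurentInv_geomSeries_mul i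
  have h4 := zCoeff_mul_prod_one_sub φ _ _ h2 Finset.univ 0
  rw [h3, Nat.cast_zero, zCoeff_zero_mapToLaurent_geomSeries, pow_zero, one_mul] at h4
  rw [h2, mul_assoc, ← h4, mul_one]

/-- `∏_{i ≠ k} (1 - xᵢ z)` as a polynomial in `z`. -/
def coprod {A : Type*} [CommRing A] (x : Fin l → A) (k : Fin l) : Polynomial A :=
  ∏ i ∈ Finset.univ.erase k, (1 - Polynomial.C (x i) * Polynomial.X)

theorem natDegree_coprod_lt {A : Type*} [CommRing A] (x : Fin l → A) (k : Fin l) :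
    (coprod x k).natDegree < l := by
  have hk : 0 < l := k.pos
  have h : (coprod x k).natDegree ≤ ∑ i ∈ Finset.univ.erase k, 1 := by
    refine (Polynomial.natDegree_prod_le _ _).trans (Finset.sum_le_sum fun i _ => ?_)
    compute_degree
  simp at h
  omega

/-- Expanding the product over `i ≠ k` in powers of `z` makes the preceding identity a linear
equation in `f_n, …, f_{n-l+1}`. -/
theorem sum_coprod_mul_fCoeff (k : Fin l) (n : ℕ) :
    (∑ m : Fin l, (coprod (fun i => (MvPowerSeries.X i : MvPowerSeries (Fin l) R)) k).coeff m *
      fCoeff R l (n - m)) *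
      ∏ i : Fin l, (1 - MvPowerSeries.X i * MvPowerSeries.X k) = MvPowerSeries.X k ^ n := by
  rw [← zCoeff_genSeries_mul_prod_erase]
  congr 1
  set x := fun i => (MvPowerSeries.X i : MvPowerSeries (Fin l) R)
  have h : ∏ i ∈ Finset.univ.erase k,
      (1 - MvPowerSeries.X i * MvPowerSeries.C (LaurentPolynomial.T 1)) =
      (coprod x k).eval₂ (MvPowerSeries.map LaurentPolynomial.C)
        (MvPowerSeries.C (LaurentPolynomial.T (R := R) 1)) := by
    rw [coprod, Polynomial.eval₂_finsetProd]
    refine Finset.prod_congr rfl fun i _ => ?_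
    simp [Polynomial.eval₂_sub, Polynomial.eval₂_mul, x]
  rw [h, Polynomial.eval₂_eq_sum_range' _ (natDegree_coprod_lt x k), Finset.mul_sum, map_sum,
    ← Fin.sum_univ_eq_sum_range (fun m => zCoeff (n : ℤ) (genSeries R l *
      ((MvPowerSeries.map LaurentPolynomial.C) ((coprod x k).coeff m) *
        MvPowerSeries.C (LaurentPolynomial.T 1) ^ m)))]
  refine Finset.sum_congr rfl fun m _ => ?_
  rw [mul_left_comm, zCoeff_map_C_mul, ← map_pow, LaurentPolynomial.T_pow, mul_comm (genSeries R l),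
    zCoeff_T_mul, fCoeff_eq_zCoeff]
  simp

end genSeries
end

noncomputable section

/-! ### Partial fractions over a field -/

section PartialFractions

variable {L : Type*} [Field L] {l : ℕ}

theorem sum_coprod_coeff_mul_pow (x : Fin l → L) (k : Fin l) {y : L} (hy : y ≠ 0) :
    ∑ m : Fin l, (coprod x k).coeff m * y ^ (l - 1 - (m : ℕ)) =
      ∏ i ∈ Finset.univ.erase k, (y - x i) := by
  have h1 : y ^ (l - 1) * (coprod x k).eval y⁻¹ = ∏ i ∈ Finset.univ.erase k, (y - x i) := by
    have hc : (Finset.univ.erase k).card = l - 1 := by simp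
    rw [coprod, Polynomial.eval_prod, ← hc, ← Finset.prod_const, ← Finset.prod_mul_distrib]
    refine Finset.prod_congr rfl fun i _ => ?_
    simp
    field_simp
  rw [← h1, Polynomial.eval_eq_sum_range' (natDegree_coprod_lt x k), Finset.mul_sum,
    ← Fin.sum_univ_eq_sum_range (fun m => y ^ (l - 1) * ((coprod x k).coeff m * y⁻¹ ^ m))]
  refine Finset.sum_congr rfl fun m _ => ?_
  have hm : l - 1 = (l - 1 - (m : ℕ)) + m := by omega
  conv_rhs => rw [hm, pow_add, inv_pow]
  field_simp

/-- The weights of the partial fraction expansion of `∏ᵢ 1 / ((1 - xᵢ z) (1 - xᵢ z⁻¹))`. -/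
def residue (x : Fin l → L) (k : Fin l) : L :=
  (∏ i : Fin l, (1 - x i * x k))⁻¹ * (∏ i ∈ Finset.univ.erase k, (x k - x i))⁻¹

theorem prod_erase_sub_ne_zero {x : Fin l → L} (hinj : Function.Injective x) (k : Fin l) :
    ∏ i ∈ Finset.univ.erase k, (x k - x i) ≠ 0 :=
  Finset.prod_ne_zero_iff.2 fun _ hi =>
    sub_ne_zero.2 fun h => (Finset.ne_of_mem_erase hi) (hinj h).symm

theorem sum_coprod_coeff_mul_pow_node (x : Fin l → L) (hx : ∀ i, x i ≠ 0) (k q : Fin l) :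
    ∑ m : Fin l, (coprod x k).coeff m * x q ^ (l - 1 - (m : ℕ)) =
      if k = q then ∏ i ∈ Finset.univ.erase k, (x k - x i) else 0 := by
  rw [sum_coprod_coeff_mul_pow x k (hx q)]
  split_ifs with h
  · rw [h]
  · exact Finset.prod_eq_zero (Finset.mem_erase.2 ⟨Ne.symm h, Finset.mem_univ q⟩) (sub_self _)

/-- For fixed `p`, the hypotheses for `k = 1, …, l` form a square linear system in `f(p), …,
f(p-l+1)`. The proposed sums solve it, since `coprod x k`, reversed, vanishes at every node except
`xₖ`; the same fact makes the system nonsingular. -/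
theorem eq_sum_residue_mul_pow {x : Fin l → L} (hx : ∀ i, x i ≠ 0)
    (hinj : Function.Injective x) (hne : ∀ i j, 1 - x i * x j ≠ 0) (f : ℤ → L)
    (hf : ∀ (k : Fin l) (n : ℕ), (∑ m : Fin l, (coprod x k).coeff m * f (n - m)) *
      ∏ i : Fin l, (1 - x i * x k) = x k ^ n) (hl : 1 ≤ l) (p : ℕ) :
    f (p - (l - 1)) = ∑ k, residue x k * x k ^ p := by
  set P : Matrix (Fin l) (Fin l) L := Matrix.of fun k m => (coprod x k).coeff m with hP
  set V : Matrix (Fin l) (Fin l) L := Matrix.of fun m q => x q ^ (l - 1 - (m : ℕ)) with hV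
  have hPV : P * V = Matrix.diagonal fun k => ∏ i ∈ Finset.univ.erase k, (x k - x i) := by
    ext k q
    rw [Matrix.mul_apply, Matrix.diagonal_apply]
    exact sum_coprod_coeff_mul_pow_node x hx k q
  have hdet : P.det ≠ 0 := by
    intro h
    have := congrArg Matrix.det hPV
    rw [Matrix.det_mul, h, zero_mul, Matrix.det_diagonal] at this
    exact Finset.prod_ne_zero_iff.2 (fun k _ => prod_erase_sub_ne_zero hinj k) this.symm
  have h0 : P.mulVec (fun m : Fin l =>
      f (p - m) - ∑ k, residue x k * x k ^ (p + (l - 1 - (m : ℕ)))) = 0 := by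
    ext k
    have hD : ∏ i : Fin l, (1 - x i * x k) ≠ 0 :=
      Finset.prod_ne_zero_iff.2 fun i _ => hne i k
    have h2 : ∑ m : Fin l, (coprod x k).coeff m *
        ∑ q, residue x q * x q ^ (p + (l - 1 - (m : ℕ))) =
        x k ^ p * (∏ i : Fin l, (1 - x i * x k))⁻¹ := by
      simp_rw [Finset.mul_sum]
      rw [Finset.sum_comm]
      calc _ = ∑ q, residue x q * x q ^ p *
            ∑ m : Fin l, (coprod x k).coeff m * x q ^ (l - 1 - (m : ℕ)) := by
            refine Finset.sum_congr rfl fun q _ => ?_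
            rw [Finset.mul_sum]
            refine Finset.sum_congr rfl fun m _ => ?_
            ring
        _ = _ := by
            simp_rw [sum_coprod_coeff_mul_pow_node x hx]
            simp only [mul_ite, mul_zero, Finset.sum_ite_eq, Finset.mem_univ, if_true]
            rw [residue, mul_assoc, mul_assoc, mul_left_comm (_⁻¹) (x k ^ p),
              inv_mul_cancel₀ (prod_erase_sub_ne_zero hinj k), mul_one, mul_comm]
    change ∑ m : Fin l, (coprod x k).coeff m *
      (f (p - m) - ∑ q, residue x q * x q ^ (p + (l - 1 - (m : ℕ)))) = 0
    simp_rw [mul_sub]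
    rw [Finset.sum_sub_distrib, h2, ← hf k p, mul_inv_cancel_right₀ hD, sub_self]
  -- The last unknown is the one with the lowest index, `p - (l-1)`, which gives the widest range of
  -- validity.
  have h1 := congrFun (Matrix.eq_zero_of_mulVec_eq_zero hdet h0) ⟨l - 1, by omega⟩
  simp only [Pi.zero_apply, sub_eq_zero, Nat.sub_self, add_zero] at h1
  rw [← h1]
  congr 1
  omega

theorem prod_prod_erase_sub (x : Fin l → L) :
    ∏ k, ∏ i ∈ Finset.univ.erase k, (x k - x i) =
      (∏ i : Fin l, ∏ j ∈ Finset.Ioi i, (x i - x j)) *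
        ∏ i : Fin l, ∏ j ∈ Finset.Ioi i, (x j - x i) := by
  rw [← Finset.prod_mul_distrib]
  simp_rw [← Finset.prod_mul_distrib]
  rw [Finset.prod_prod_Ioi_mul_eq_prod_prod_off_diag (fun i j => x j - x i)]
  refine Finset.prod_congr rfl fun k _ => Finset.prod_congr ?_ fun i _ => rfl
  ext; simp

theorem prod_prod_one_sub_mul (x : Fin l → L) :
    ∏ k, ∏ i : Fin l, (1 - x i * x k) = (∏ k, (1 - x k * x k)) *
      ((∏ i : Fin l, ∏ j ∈ Finset.Ioi i, (1 - x i * x j)) *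
        ∏ i : Fin l, ∏ j ∈ Finset.Ioi i, (1 - x i * x j)) := by
  have h := Finset.prod_prod_Ioi_mul_eq_prod_prod_off_diag (fun i j => 1 - x i * x j)
  have h' : ∏ i : Fin l, ∏ j ∈ Finset.Ioi i, ((1 - x j * x i) * (1 - x i * x j)) =
      (∏ i : Fin l, ∏ j ∈ Finset.Ioi i, (1 - x i * x j)) *
        ∏ i : Fin l, ∏ j ∈ Finset.Ioi i, (1 - x i * x j) := by
    simp_rw [← Finset.prod_mul_distrib]
    refine Finset.prod_congr rfl fun i _ => Finset.prod_congr rfl fun j _ => ?_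
    ring
  rw [← h', h, ← Finset.prod_mul_distrib]
  refine Finset.prod_congr rfl fun k _ => ?_
  rw [← Fintype.prod_eq_mul_prod_compl k (fun i => 1 - x i * x k)]

/-- The first Vandermonde factor cancels against `a_δ`; the second, the diagonal product and one
copy of `∏ (1 - xᵢxⱼ)` make up the symplectic Weyl denominator. The other copy survives in the
result. -/
theorem prod_residue {x : Fin l → L} (hinj : Function.Injective x)
    (hne : ∀ i j, 1 - x i * x j ≠ 0) :
    (∏ k, residue x k) * ((∏ i : Fin l, ∏ j ∈ Finset.Ioi i, (x i - x j)) *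
      (∏ i : Fin l, ∏ j ∈ Finset.Ioi i, (x j - x i)) * (∏ k, (1 - x k * x k)) *
      (∏ i : Fin l, ∏ j ∈ Finset.Ioi i, (1 - x i * x j)) *
        ∏ i : Fin l, ∏ j ∈ Finset.Ioi i, (1 - x i * x j)) = 1 := by
  have h : ∏ k, residue x k * ((∏ i ∈ Finset.univ.erase k, (x k - x i)) *
      ∏ i : Fin l, (1 - x i * x k)) = 1 := by
    refine Finset.prod_eq_one fun k _ => ?_
    have h1 := prod_erase_sub_ne_zero hinj k
    have h2 : ∏ i : Fin l, (1 - x i * x k) ≠ 0 :=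
      Finset.prod_ne_zero_iff.2 fun i _ => hne i k
    rw [residue, mul_comm (_⁻¹), mul_mul_mul_comm, inv_mul_cancel₀ h1, inv_mul_cancel₀ h2,
      mul_one]
  rw [Finset.prod_mul_distrib, Finset.prod_mul_distrib, prod_prod_erase_sub,
    prod_prod_one_sub_mul] at h
  simpa only [mul_assoc] using h

end PartialFractions

/-! ### Weyl denominators of types C, B and D -/

section WeylDenominators

variable {L : Type*} [Field L]

/-- Monic polynomials with `p₀ = 1`, `p₁ = X + c`, `p₂ = X p₁ - b` and
`pₙ₊₂ = X pₙ₊₁ - pₙ` afterwards. -/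
def chebPoly (b c : L) : ℕ → Polynomial L
  | 0 => 1
  | 1 => Polynomial.X + Polynomial.C c
  | n + 2 => Polynomial.X * chebPoly b c (n + 1) -
      Polynomial.C (if n = 0 then b else 1) * chebPoly b c n

theorem chebPoly_monic_and_natDegree (b c : L) (n : ℕ) :
    (chebPoly b c n).Monic ∧ (chebPoly b c n).natDegree = n := by
  induction n using Nat.strong_induction_on with
  | _ n ih =>
    match n with
    | 0 => simp [chebPoly]
    | 1 => exact ⟨Polynomial.monic_X_add_C c, Polynomial.natDegree_X_add_C c⟩
    | n + 2 =>
      obtain ⟨hm, hd⟩ := ih (n + 1) (by omega)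
      obtain ⟨-, hd'⟩ := ih n (by omega)
      have h1 : (Polynomial.X * chebPoly b c (n + 1)).natDegree = n + 2 := by
        rw [Polynomial.natDegree_X_mul hm.ne_zero, hd]
      have h2 : (Polynomial.C (if n = 0 then b else 1) * chebPoly b c n).natDegree <
          (Polynomial.X * chebPoly b c (n + 1)).natDegree := by
        have := Polynomial.natDegree_C_mul_le (if n = 0 then b else 1) (chebPoly b c n)
        omega
      refine ⟨(Polynomial.monic_X.mul hm).sub_of_left (Polynomial.degree_lt_degree h2), ?_⟩
      rw [chebPoly, Polynomial.natDegree_sub_eq_left_of_natDegree_lt h2, h1]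

theorem chebPoly_one_zero_eval {x : L} (hx : x ≠ 0) (n : ℕ) :
    x ^ n * (1 - x * x) * (chebPoly 1 0 n).eval (x + x⁻¹) = 1 - x ^ (2 * n + 2) := by
  induction n using Nat.twoStepInduction with
  | zero => simp [chebPoly]; ring
  | one => simp [chebPoly]; field_simp; ring
  | more n h0 h1 =>
    simp only [chebPoly, Polynomial.eval_sub, Polynomial.eval_mul, Polynomial.eval_X,
      Polynomial.eval_C, ite_self]
    have e : x * (x + x⁻¹) = x * x + 1 := by field_simp
    linear_combination (x * x + 1) * h1 - x ^ 2 * h0 + x ^ (n + 1) * (1 - x * x) *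
      (chebPoly 1 0 (n + 1)).eval (x + x⁻¹) * e

theorem chebPoly_one_one_eval {x : L} (hx : x ≠ 0) (n : ℕ) :
    x ^ n * (1 - x) * (chebPoly 1 1 n).eval (x + x⁻¹) = 1 - x ^ (2 * n + 1) := by
  induction n using Nat.twoStepInduction with
  | zero => simp [chebPoly]
  | one => simp [chebPoly]; field_simp; ring
  | more n h0 h1 =>
    simp only [chebPoly, Polynomial.eval_sub, Polynomial.eval_mul, Polynomial.eval_X,
      Polynomial.eval_C, ite_self]
    have e : x * (x + x⁻¹) = x * x + 1 := by field_simp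
    linear_combination (x * x + 1) * h1 - x ^ 2 * h0 + x ^ (n + 1) * (1 - x) *
      (chebPoly 1 1 (n + 1)).eval (x + x⁻¹) * e

/-- Here `pₙ(x + x⁻¹) = xⁿ + x⁻ⁿ` for `n ≥ 1`. Monicity forces `p₀ = 1` instead of `2`, hence the
factor at `n = 0` and `b = 2` in the recurrence. -/
theorem chebPoly_two_zero_eval {x : L} (hx : x ≠ 0) (n : ℕ) :
    (if n = 0 then 2 else 1) * (x ^ n * (chebPoly 2 0 n).eval (x + x⁻¹)) = 1 + x ^ (2 * n) := by
  induction n using Nat.twoStepInduction with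
  | zero => simp [chebPoly]; ring
  | one => simp [chebPoly]; field_simp; ring
  | more n h0 h1 =>
    simp only [chebPoly, Polynomial.eval_sub, Polynomial.eval_mul, Polynomial.eval_X,
      Polynomial.eval_C]
    have e : x * (x + x⁻¹) = x * x + 1 := by field_simp
    simp only [Nat.add_eq_zero_iff, one_ne_zero, OfNat.ofNat_ne_zero, and_false, if_false] at h1 ⊢
    linear_combination (x * x + 1) * h1 - x ^ 2 * h0 + x ^ (n + 1) *
      (chebPoly 2 0 (n + 1)).eval (x + x⁻¹) * e

variable {l : ℕ}

theorem det_eval_monic_rev (v : Fin l → L) (p : ℕ → Polynomial L) (hp : ∀ n, (p n).Monic)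
    (hd : ∀ n, (p n).natDegree = n) :
    (Matrix.of fun i j : Fin l => (p (Fin.rev j)).eval (v i)).det =
      (Matrix.of fun i j : Fin l => v i ^ (Fin.rev j : ℕ)).det := by
  have h1 := Matrix.det_permute' Fin.revPerm
    (Matrix.of fun i j : Fin l => (p (j : ℕ)).eval (v i))
  have h2 := Matrix.det_permute' Fin.revPerm (Matrix.vandermonde v)
  rw [Matrix.det_eval_matrixOfPolynomials_eq_det_vandermonde v (fun j => p j)
    (fun j => hd j) (fun j => hp j), ← h1] at h2
  exact h2.symm

/-- Monic polynomials of degrees `0, …, l-1` may be replaced by powers, leaving a Vandermonde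
determinant in `xᵢ + xᵢ⁻¹`. The row factors `xᵢ^(l-1)` clear denominators, and `xⱼ(1 + xᵢ²) - xᵢ(1 +
xⱼ²) = (xⱼ - xᵢ)(1 - xᵢxⱼ)`. -/
theorem det_pow_mul_chebPoly_eval (b c : L) {x : Fin l → L} (hx : ∀ i, x i ≠ 0) :
    (Matrix.of fun i j : Fin l =>
      x i ^ (l - 1) * (chebPoly b c (Fin.rev j)).eval (x i + (x i)⁻¹)).det =
      (∏ i : Fin l, ∏ j ∈ Finset.Ioi i, (x j - x i)) *
        ∏ i : Fin l, ∏ j ∈ Finset.Ioi i, (1 - x i * x j) := by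
  have h1 := Matrix.det_mul_column (fun i => x i ^ (l - 1)) (Matrix.of fun i j : Fin l =>
    (chebPoly b c (Fin.rev j)).eval (x i + (x i)⁻¹))
  rw [det_eval_monic_rev _ _ (fun n => (chebPoly_monic_and_natDegree b c n).1)
    (fun n => (chebPoly_monic_and_natDegree b c n).2), ← Matrix.det_mul_column] at h1
  refine h1.trans ?_
  have h2 : (Matrix.of fun i j : Fin l => x i ^ (l - 1) *
      (Matrix.of fun i j : Fin l => (x i + (x i)⁻¹) ^ (Fin.rev j : ℕ)) i j) =
      Matrix.projVandermonde x (fun i => 1 + x i * x i) := by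
    ext i j
    rw [Matrix.projVandermonde_apply, Matrix.of_apply, Matrix.of_apply,
      show l - 1 = j + (Fin.rev j : ℕ) by rw [Fin.val_rev]; omega, pow_add, mul_assoc, ← mul_pow]
    congr 2
    have := hx i
    field_simp
    ring
  rw [h2, Matrix.det_projVandermonde]
  simp_rw [← Finset.prod_mul_distrib]
  refine Finset.prod_congr rfl fun i _ => Finset.prod_congr rfl fun j _ => ?_
  ring

theorem det_pow_sub_pow_symplectic {x : Fin l → L} (hx : ∀ i, x i ≠ 0) :
    (Matrix.of fun k j : Fin l => x k ^ (j : ℕ) - x k ^ (2 * l - j)).det =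
      (∏ k, (1 - x k * x k)) * ((∏ i : Fin l, ∏ j ∈ Finset.Ioi i, (x j - x i)) *
        ∏ i : Fin l, ∏ j ∈ Finset.Ioi i, (1 - x i * x j)) := by
  rw [← det_pow_mul_chebPoly_eval 1 0 hx, ← Matrix.det_mul_column]
  congr 1
  ext k j
  simp only [Matrix.of_apply]
  have h := chebPoly_one_zero_eval (hx k) (Fin.rev j)
  have hj : (Fin.rev j : ℕ) = l - (j + 1) := Fin.val_rev j
  rw [show 2 * l - (j : ℕ) = j + (2 * (Fin.rev j : ℕ) + 2) by omega, pow_add,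
    show l - 1 = j + (Fin.rev j : ℕ) by omega, pow_add]
  linear_combination -(x k ^ (j : ℕ)) * h

theorem det_pow_sub_pow_odd_orthogonal {x : Fin l → L} (hx : ∀ i, x i ≠ 0) :
    (Matrix.of fun k j : Fin l => x k ^ (j : ℕ) - x k ^ (2 * l - 1 - j)).det =
      (∏ k, (1 - x k)) * ((∏ i : Fin l, ∏ j ∈ Finset.Ioi i, (x j - x i)) *
        ∏ i : Fin l, ∏ j ∈ Finset.Ioi i, (1 - x i * x j)) := by
  rw [← det_pow_mul_chebPoly_eval 1 1 hx, ← Matrix.det_mul_column]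
  congr 1
  ext k j
  simp only [Matrix.of_apply]
  have h := chebPoly_one_one_eval (hx k) (Fin.rev j)
  have hj : (Fin.rev j : ℕ) = l - (j + 1) := Fin.val_rev j
  rw [show 2 * l - 1 - (j : ℕ) = j + (2 * (Fin.rev j : ℕ) + 1) by omega, pow_add,
    show l - 1 = j + (Fin.rev j : ℕ) by omega, pow_add]
  linear_combination -(x k ^ (j : ℕ)) * h

theorem det_pow_add_pow_even_orthogonal (hl : 1 ≤ l) {x : Fin l → L} (hx : ∀ i, x i ≠ 0) :
    (Matrix.of fun k j : Fin l => x k ^ (j : ℕ) + x k ^ (2 * l - 2 - j)).det =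
      2 * ((∏ i : Fin l, ∏ j ∈ Finset.Ioi i, (x j - x i)) *
        ∏ i : Fin l, ∏ j ∈ Finset.Ioi i, (1 - x i * x j)) := by
  -- In the last column, `j = l-1`, the two exponents coincide; this is the source of the factor
  -- `2`.
  have h2 : ∏ j : Fin l, (if (Fin.rev j : ℕ) = 0 then (2 : L) else 1) = 2 := by
    rw [Fintype.prod_eq_single ⟨l - 1, by omega⟩]
    · simp only [Fin.val_rev]
      rw [if_pos (by omega)]
    · intro j hj
      rw [if_neg]
      rw [Fin.val_rev]
      rw [Ne, Fin.ext_iff] at hj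
      simp only at hj
      omega
  rw [← det_pow_mul_chebPoly_eval 2 0 hx]
  refine Eq.trans ?_ (congrArg (· * _) h2)
  rw [← Matrix.det_mul_row]
  congr 1
  ext k j
  simp only [Matrix.of_apply]
  have h := chebPoly_two_zero_eval (hx k) (Fin.rev j)
  have hj : (Fin.rev j : ℕ) = l - (j + 1) := Fin.val_rev j
  rw [show 2 * l - 2 - (j : ℕ) = j + 2 * (Fin.rev j : ℕ) by omega, pow_add,
    show l - 1 = j + (Fin.rev j : ℕ) by omega, pow_add]
  linear_combination -(x k ^ (j : ℕ)) * h

end WeylDenominators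
end

noncomputable section

/-! ### The three identities over a field -/

section FieldIdentities

variable {L : Type*} [Field L] {l : ℕ}

theorem det_sum_mul_mul (x w : Fin l → L) (a : Fin l → ℕ) (u : Fin l → Fin l → L) :
    (Matrix.of fun i j : Fin l => ∑ k, w k * x k ^ a i * u k j).det =
      (Matrix.of fun k i : Fin l => x k ^ a i).det * (∏ k, w k) * (Matrix.of u).det := by
  rw [← Matrix.det_transpose (Matrix.of fun k i : Fin l => x k ^ a i), ← Matrix.det_diagonal,
    ← Matrix.det_mul, ← Matrix.det_mul]
  congr 1
  ext i j
  rw [Matrix.mul_apply, Matrix.of_apply]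
  refine Finset.sum_congr rfl fun k _ => ?_
  rw [Matrix.mul_diagonal, Matrix.transpose_apply, Matrix.of_apply, Matrix.of_apply,
    mul_comm (w k)]

theorem prod_Ici_one_sub (x : Fin l → L) :
    ∏ i : Fin l, ∏ j ∈ Finset.Ici i, (1 - x i * x j) =
      (∏ k, (1 - x k * x k)) * ∏ i : Fin l, ∏ j ∈ Finset.Ioi i, (1 - x i * x j) := by
  rw [← Finset.prod_mul_distrib]
  exact Finset.prod_congr rfl fun i _ =>
    (Finset.mul_prod_Ioi_eq_prod_Ici (f := fun j => 1 - x i * x j) i).symm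

variable {x : Fin l → L} (hx : ∀ i, x i ≠ 0) (hinj : Function.Injective x)
  (hne : ∀ i j, 1 - x i * x j ≠ 0) (hl : 1 ≤ l) (f : ℤ → L)
  (hf : ∀ p : ℕ, f (p - (l - 1)) = ∑ k, residue x k * x k ^ p)
  (lam : Fin l → ℕ) (s : L)
  (hs : (Matrix.of fun k i : Fin l => x k ^ (lam i + (l - 1 - (i : ℕ)))).det =
    (∏ i : Fin l, ∏ j ∈ Finset.Ioi i, (x i - x j)) * s)

include hf in
theorem eq_sum_residue_of_eq (N : ℤ) (i : Fin l) (e : ℕ)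
    (hN : N = lam i - i + e) :
    f N = ∑ k, residue x k * x k ^ (lam i + (l - 1 - (i : ℕ))) * x k ^ e := by
  -- The shifted index `N + l - 1` is a sum of natural numbers, so the expansion applies.
  rw [show N = ((lam i + (l - 1 - (i : ℕ)) + e : ℕ) : ℤ) - (l - 1) by omega, hf]
  exact Finset.sum_congr rfl fun k _ => by ring

include hx hinj hne hf hs in
theorem det_sub_symplectic :
    (∏ i : Fin l, ∏ j ∈ Finset.Ioi i, (1 - x i * x j)) *
      (Matrix.of fun i j : Fin l =>
        f ((lam i : ℤ) - ((i : ℤ) + 1) + ((j : ℤ) + 1)) -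
          f ((lam i : ℤ) - ((i : ℤ) + 1) - ((j : ℤ) + 1) + 2 * (l : ℤ) + 2)).det = s := by
  have h : (Matrix.of fun i j : Fin l =>
        f ((lam i : ℤ) - ((i : ℤ) + 1) + ((j : ℤ) + 1)) -
          f ((lam i : ℤ) - ((i : ℤ) + 1) - ((j : ℤ) + 1) + 2 * (l : ℤ) + 2)) =
      Matrix.of fun i j : Fin l => ∑ k, residue x k * x k ^ (lam i + (l - 1 - (i : ℕ))) *
        (x k ^ (j : ℕ) - x k ^ (2 * l - j)) := by
    ext i j
    simp only [Matrix.of_apply, mul_sub, Finset.sum_sub_distrib]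
    rw [eq_sum_residue_of_eq f hf lam _ i j (by omega),
      eq_sum_residue_of_eq f hf lam _ i (2 * l - j) (by omega)]
  rw [h, det_sum_mul_mul, hs, det_pow_sub_pow_symplectic hx]
  linear_combination s * prod_residue hinj hne

include hx hinj hne hf hs in
theorem det_sub_odd_orthogonal :
    ((∏ j : Fin l, (1 + x j)) * ∏ i : Fin l, ∏ j ∈ Finset.Ioi i, (1 - x i * x j)) *
      (Matrix.of fun i j : Fin l =>
        f ((lam i : ℤ) - ((i : ℤ) + 1) + ((j : ℤ) + 1)) -
          f ((lam i : ℤ) - ((i : ℤ) + 1) - ((j : ℤ) + 1) + 2 * (l : ℤ) + 1)).det = s := by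
  have h : (Matrix.of fun i j : Fin l =>
        f ((lam i : ℤ) - ((i : ℤ) + 1) + ((j : ℤ) + 1)) -
          f ((lam i : ℤ) - ((i : ℤ) + 1) - ((j : ℤ) + 1) + 2 * (l : ℤ) + 1)) =
      Matrix.of fun i j : Fin l => ∑ k, residue x k * x k ^ (lam i + (l - 1 - (i : ℕ))) *
        (x k ^ (j : ℕ) - x k ^ (2 * l - 1 - j)) := by
    ext i j
    simp only [Matrix.of_apply, mul_sub, Finset.sum_sub_distrib]
    rw [eq_sum_residue_of_eq f hf lam _ i j (by omega),
      eq_sum_residue_of_eq f hf lam _ i (2 * l - 1 - j) (by omega)]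
  have h1 : ∏ k, (1 - x k * x k) = (∏ k, (1 + x k)) * ∏ k, (1 - x k) := by
    rw [← Finset.prod_mul_distrib]
    exact Finset.prod_congr rfl fun k _ => by ring
  have h2 := prod_residue hinj hne
  rw [h1] at h2
  rw [h, det_sum_mul_mul, hs, det_pow_sub_pow_odd_orthogonal hx]
  linear_combination s * h2

include hx hinj hne hf hs hl in
theorem det_add_even_orthogonal :
    (∏ i : Fin l, ∏ j ∈ Finset.Ici i, (1 - x i * x j)) *
      (Matrix.of fun i j : Fin l =>
        f ((lam i : ℤ) - ((i : ℤ) + 1) + ((j : ℤ) + 1)) +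
          f ((lam i : ℤ) - ((i : ℤ) + 1) - ((j : ℤ) + 1) + 2 * (l : ℤ))).det = 2 * s := by
  have h : (Matrix.of fun i j : Fin l =>
        f ((lam i : ℤ) - ((i : ℤ) + 1) + ((j : ℤ) + 1)) +
          f ((lam i : ℤ) - ((i : ℤ) + 1) - ((j : ℤ) + 1) + 2 * (l : ℤ))) =
      Matrix.of fun i j : Fin l => ∑ k, residue x k * x k ^ (lam i + (l - 1 - (i : ℕ))) *
        (x k ^ (j : ℕ) + x k ^ (2 * l - 2 - j)) := by
    ext i j
    simp only [Matrix.of_apply, mul_add, Finset.sum_add_distrib]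
    rw [eq_sum_residue_of_eq f hf lam _ i j (by omega),
      eq_sum_residue_of_eq f hf lam _ i (2 * l - 2 - j) (by omega)]
  rw [h, det_sum_mul_mul, hs, det_pow_add_pow_even_orthogonal hl hx, prod_Ici_one_sub]
  linear_combination 2 * s * prod_residue hinj hne

end FieldIdentities

/-! ### Return to power series -/

section Series

theorem alternant_delta_eq (R : Type*) [CommRing R] (l : ℕ) :
    alternant R (fun j : Fin l => l - 1 - (j : ℕ)) =
      ∏ i : Fin l, ∏ j ∈ Finset.Ioi i,
        ((MvPolynomial.X i : MvPolynomial (Fin l) R) - MvPolynomial.X j) := by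
  have h : alternant R (fun j : Fin l => l - 1 - (j : ℕ)) =
      (Matrix.projVandermonde 1
        (fun i : Fin l => (MvPolynomial.X i : MvPolynomial (Fin l) R))).det := by
    unfold alternant
    congr 1
    ext1 i j
    rw [Matrix.projVandermonde_apply, Matrix.of_apply, Fin.val_rev, Pi.one_apply, one_pow,
      one_mul, Nat.add_comm, ← Nat.sub_sub]
  rw [h, Matrix.det_projVandermonde]
  simp

theorem map_det_of {R S : Type*} [CommRing R] [CommRing S] {l : ℕ} (φ : R →+* S)
    (u : Fin l → Fin l → R) :
    φ (Matrix.of u).det = (Matrix.of fun i j => φ (u i j)).det := by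
  rw [RingHom.map_det]
  rfl

end Series
end

theorem theoreme {K : Type*} [Field K] [CharZero K] (l : ℕ) (hl : 1 ≤ l)
    (lam : Fin l → ℕ) (hlam : Antitone lam) :
    (Matrix.of fun i j : Fin l =>
        fCoeff K l ((lam i : ℤ) - ((i : ℤ) + 1) + ((j : ℤ) + 1)) -
          fCoeff K l ((lam i : ℤ) - ((i : ℤ) + 1) - ((j : ℤ) + 1) + 2 * (l : ℤ) + 2)).det =
      (∏ i : Fin l, ∏ j ∈ Finset.Ioi i,
          (1 - MvPowerSeries.X i * MvPowerSeries.X j : MvPowerSeries (Fin l) K))⁻¹ *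
        (schurPoly K lam : MvPowerSeries (Fin l) K) ∧
    (Matrix.of fun i j : Fin l =>
        fCoeff K l ((lam i : ℤ) - ((i : ℤ) + 1) + ((j : ℤ) + 1)) -
          fCoeff K l ((lam i : ℤ) - ((i : ℤ) + 1) - ((j : ℤ) + 1) + 2 * (l : ℤ) + 1)).det =
      (∏ j : Fin l, (1 + MvPowerSeries.X j : MvPowerSeries (Fin l) K))⁻¹ *
        (∏ i : Fin l, ∏ j ∈ Finset.Ioi i,
          (1 - MvPowerSeries.X i * MvPowerSeries.X j : MvPowerSeries (Fin l) K))⁻¹ *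
        (schurPoly K lam : MvPowerSeries (Fin l) K) ∧
    (1 / 2 : K) • (Matrix.of fun i j : Fin l =>
        fCoeff K l ((lam i : ℤ) - ((i : ℤ) + 1) + ((j : ℤ) + 1)) +
          fCoeff K l ((lam i : ℤ) - ((i : ℤ) + 1) - ((j : ℤ) + 1) + 2 * (l : ℤ))).det =
      (∏ i : Fin l, ∏ j ∈ Finset.Ici i,
          (1 - MvPowerSeries.X i * MvPowerSeries.X j : MvPowerSeries (Fin l) K))⁻¹ *
        (schurPoly K lam : MvPowerSeries (Fin l) K) := by
  have : IsDomain (MvPowerSeries (Fin l) K) := NoZeroDivisors.to_isDomain _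
  let φ : MvPowerSeries (Fin l) K →+* FractionRing (MvPowerSeries (Fin l) K) := algebraMap _ _
  have hφ : Function.Injective φ := IsFractionRing.injective _ _
  set x : Fin l → FractionRing (MvPowerSeries (Fin l) K) := fun i => φ (MvPowerSeries.X i)
    with hxdef
  have hX : Function.Injective (MvPowerSeries.X : Fin l → MvPowerSeries (Fin l) K) := by
    intro i j h
    rw [← MvPolynomial.coe_X, ← MvPolynomial.coe_X] at h
    exact MvPolynomial.X_injective (MvPolynomial.coe_injective _ _ h)
  have hX0 : ∀ i, (MvPowerSeries.X i : MvPowerSeries (Fin l) K) ≠ 0 := by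
    intro i h
    rw [← MvPolynomial.coe_X, ← MvPolynomial.coe_zero] at h
    exact MvPolynomial.X_ne_zero i (MvPolynomial.coe_injective _ _ h)
  have hx : ∀ i, x i ≠ 0 := fun i => (map_ne_zero_iff φ hφ).2 (hX0 i)
  have hinj : Function.Injective x := hφ.comp hX
  -- The constant coefficient of `1 - XᵢXⱼ` is `1`, also for `i = j`.
  have hne : ∀ i j, 1 - x i * x j ≠ 0 := by
    intro i j
    rw [← map_one φ, ← map_mul, ← map_sub, map_ne_zero_iff φ hφ]
    intro h
    simpa using congrArg MvPowerSeries.constantCoeff h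
  have hf := eq_sum_residue_mul_pow hx hinj hne (fun n => φ (fCoeff K l n)) (by
    intro k n
    have h := congrArg φ (sum_coprod_mul_fCoeff K k n)
    simp only [map_mul, map_sum, map_prod, map_sub, map_one, map_pow] at h
    rw [← h]
    congr 1
    refine Finset.sum_congr rfl fun m _ => ?_
    congr 1
    have hc : coprod x k = (coprod (fun i => MvPowerSeries.X i) k).map φ := by
      simp [coprod, Polynomial.map_prod, hxdef]
    rw [hc, Polynomial.coeff_map]) hl
  have hs : (Matrix.of fun k i : Fin l => x k ^ (lam i + (l - 1 - (i : ℕ)))).det =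
      (∏ i : Fin l, ∏ j ∈ Finset.Ioi i, (x i - x j)) * φ (schurPoly K lam) := by
    have h := congrArg (fun p : MvPolynomial (Fin l) K =>
      φ (MvPolynomial.coeToMvPowerSeries.ringHom p)) (schurPoly_spec K lam)
    rw [alternant_delta_eq] at h
    simp only [alternant, map_mul, map_prod, map_sub, map_det_of,
      map_pow, MvPolynomial.coeToMvPowerSeries.ringHom_apply, MvPolynomial.coe_X] at h
    exact h
  have hc1 : MvPowerSeries.constantCoeff (∏ i : Fin l, ∏ j ∈ Finset.Ioi i,
      (1 - MvPowerSeries.X i * MvPowerSeries.X j : MvPowerSeries (Fin l) K)) ≠ 0 := by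
    simp [map_prod]
  have hc2 : MvPowerSeries.constantCoeff
      (∏ j : Fin l, (1 + MvPowerSeries.X j : MvPowerSeries (Fin l) K)) ≠ 0 := by
    simp [map_prod]
  have hc3 : MvPowerSeries.constantCoeff (∏ i : Fin l, ∏ j ∈ Finset.Ici i,
      (1 - MvPowerSeries.X i * MvPowerSeries.X j : MvPowerSeries (Fin l) K)) ≠ 0 := by
    simp [map_prod]
  -- Identities cleared of denominators descend from the fraction field, and there `E` can be
  -- inverted as a power series.
  have hdiv : ∀ {E M S : MvPowerSeries (Fin l) K}, MvPowerSeries.constantCoeff E ≠ 0 →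
      φ E * φ M = φ S → M = E⁻¹ * S := by
    intro E M S hE h
    rw [← map_mul] at h
    rw [mul_comm, MvPowerSeries.eq_mul_inv_iff_mul_eq hE, mul_comm, hφ h]
  refine ⟨hdiv hc1 ?_, ?_, ?_⟩
  · have h := det_sub_symplectic hx hinj hne (fun n => φ (fCoeff K l n)) hf lam _ hs
    simp only [map_mul, map_prod, map_sub, map_one, map_det_of]
    exact h
  · rw [mul_comm (_⁻¹) (_⁻¹), ← MvPowerSeries.mul_inv_rev]
    refine hdiv (by rw [map_mul]; exact mul_ne_zero hc2 hc1) ?_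
    have h := det_sub_odd_orthogonal hx hinj hne (fun n => φ (fCoeff K l n)) hf lam _ hs
    simp only [map_mul, map_prod, map_sub, map_add, map_one, map_det_of]
    exact h
  · refine hdiv hc3 ?_
    have h := det_add_even_orthogonal hx hinj hne hl (fun n => φ (fCoeff K l n)) hf lam _ hs
    have h2 : φ (MvPowerSeries.C (1 / 2 : K)) * 2 = 1 := by
      have h3 : (2 : MvPowerSeries (Fin l) K) = MvPowerSeries.C (2 : K) :=
        (map_ofNat MvPowerSeries.C 2).symm
      rw [← map_ofNat φ 2, ← map_mul, h3, ← map_mul, one_div, inv_mul_cancel₀ two_ne_zero,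
        map_one, map_one]
    rw [MvPowerSeries.smul_eq_C_mul, map_mul, mul_left_comm]
    simp only [map_mul, map_prod, map_sub, map_add, map_one, map_det_of]
    refine (congrArg (φ (MvPowerSeries.C (1 / 2 : K)) * ·) h).trans ?_
    rw [← mul_assoc, h2, one_mul]
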